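/- **Lemma 7.2.** *Conventions.* For a set $x$ let $\rho_{\mathbf H}(x)=\max(\aleph_0,|\mathrm{trcl}(x)|)$, i.e. the least infinite $\kappa$ with $x\in \mathbf H_{\kappa^+}$. In many-sorted first-order logic, domains being nonempty, call a class $\mathcal K$ of $\tau$-structures *$\Sigma^{\mathrm B}(\mathcal L_{\omega\omega})$-axiomatisable* if there is a first-order sentence $\chi$ in some vocabulary $\tau'\supseteq\tau$ (possibly with additional sorts and symbols) such that $\mathcal K$ is the class of reducts to $\tau$ of the models of $\chi$, and for every $\tau$-structure $\mathcal A$ there is a cardinal $\lambda_{\mathcal A}$ such that $|\mathcal B|\le\lambda_{\mathcal A}$ for every model $\mathcal B$ of $\chi$ with $\mathcal B{\upharpoonright}\tau=\mathcal A$. A non-decreasing function $F:\mathrm{Card}\to\mathrm{Card}$ is *definably bounding* if the class of all two-sorted structures $(A,B)$ (with no symbols) satisfying $|B|\le F(|A|)$ is $\Sigma^{\mathrm B}(\mathcal L_{\omega\omega})$-axiomatisable. For a definably bounding $F$ and a set-theoretic predicate $R$ (of any finite arity), a property $\phi(x)$ of sets $x$ is *$\Sigma_1^F(R)$* if there is a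 parameter-free $\Delta_0$ formula $\psi(x,y)$ of the language $\{\in,R\}$ such that (a) for all $x$, $\phi(x)$ holds if and only if $\exists y\,\psi(x,y)$, and (b) for all $x$, if $\phi(x)$ holds then there is $y'$ with $\rho_{\mathbf H}(y')\le F(\rho_{\mathbf H}(x))$ and $\psi(x,y')$. Let $\mathrm{PwSt}(x,y)$ be the predicate "$y=\wp(x)$". A predicate $R$ is $\Pi_1$ if it is defined by a formula $\forall w\,\theta$ with $\theta$ a parameter-free $\Delta_0$ formula of the language $\{\in\}$. *Statement.* For every definably bounding function $F$ there is a definably bounding function $F''$ such that for every $\Pi_1$ predicate $R$, every property $\phi(x)$ that is $\Sigma_1^F(R)$ is also $\Sigma_1^{F''}(\mathrm{PwSt})$. -/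

import Mathlib

open Cardinal

universe u

/-! ## Many-sorted first-order logic -/

/-- A many-sorted vocabulary: a set of sorts, relation symbols and function symbols (constants are
the function symbols with no argument), each symbol with its sorts specified. -/
structure MSVocab : Type (u + 1) where
  Srt : Type u
  Rel : Type u
  relArity : Rel → ℕ
  relSrt : (r : Rel) → Fin (relArity r) → Srt
  Fn : Type u
  fnArity : Fn → ℕ
  fnSrt : (f : Fn) → Fin (fnArity f) → Srt
  fnCod : Fn → Srt

/-- A structure for a many-sorted vocabulary: a nonempty domain for every sort, and an
interpretation of every symbol. -/
structure MSStruct (τ : MSVocab.{u}) : Type (u + 1) where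
  Dom : τ.Srt → Type u
  nonempty : ∀ s, Nonempty (Dom s)
  rel : (r : τ.Rel) → ((i : Fin (τ.relArity r)) → Dom (τ.relSrt r i)) → Prop
  fn : (f : τ.Fn) → ((i : Fin (τ.fnArity f)) → Dom (τ.fnSrt f i)) → Dom (τ.fnCod f)

/-- The cardinality of a many-sorted structure: the cardinality of the disjoint union of its
domains. -/
noncomputable def MSStruct.card {τ : MSVocab.{u}} (M : MSStruct τ) : Cardinal.{u} :=
  #(Σ s, M.Dom s)

/-- First-order terms; every sort `s` has its own variables `var s 0, var s 1, …`. -/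
inductive MSTerm (τ : MSVocab.{u}) : τ.Srt → Type u
  | var (s : τ.Srt) (n : ℕ) : MSTerm τ s
  | app (f : τ.Fn) (ts : (i : Fin (τ.fnArity f)) → MSTerm τ (τ.fnSrt f i)) : MSTerm τ (τ.fnCod f)

/-- First-order (finitary) formulas of a many-sorted vocabulary. -/
inductive MSFormula (τ : MSVocab.{u}) : Type u
  | falsum : MSFormula τ
  | eq (s : τ.Srt) (t₁ t₂ : MSTerm τ s) : MSFormula τ
  | rel (r : τ.Rel) (ts : (i : Fin (τ.relArity r)) → MSTerm τ (τ.relSrt r i)) : MSFormula τ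
  | imp (φ ψ : MSFormula τ) : MSFormula τ
  | all (s : τ.Srt) (n : ℕ) (φ : MSFormula τ) : MSFormula τ

/-- An assignment gives a value, in the right domain, to every variable `(s, n)`. -/
abbrev MSStruct.Assignment {τ : MSVocab.{u}} (M : MSStruct τ) : Type u :=
  (p : τ.Srt × ℕ) → M.Dom p.1

def MSTerm.val {τ : MSVocab.{u}} (M : MSStruct τ) (v : M.Assignment) :
    {s : τ.Srt} → MSTerm τ s → M.Dom s
  | _, .var s n => v (s, n)
  | _, .app f ts => M.fn f fun i => (ts i).val M v

open Classical in
def MSFormula.Sat {τ : MSVocab.{u}} (M : MSStruct τ) : MSFormula τ → M.Assignment → Prop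
  | .falsum, _ => False
  | .eq _ t₁ t₂, v => t₁.val M v = t₂.val M v
  | .rel r ts, v => M.rel r fun i => (ts i).val M v
  | .imp φ ψ, v => φ.Sat M v → ψ.Sat M v
  | .all s n φ, v => ∀ a : M.Dom s, φ.Sat M (Function.update v (s, n) a)

/-- `M ⊨ φ`: satisfaction of a sentence. A formula with free variables stands for the sentence that
is its universal closure. -/
def MSStruct.Models {τ : MSVocab.{u}} (M : MSStruct τ) (φ : MSFormula τ) : Prop :=
  ∀ v : M.Assignment, φ.Sat M v

/-- The data of a vocabulary extending `τ`: the additional sorts and symbols. The additional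
symbols may involve old and new sorts. -/
structure MSExt (τ : MSVocab.{u}) : Type (u + 1) where
  Srt : Type u
  Rel : Type u
  relArity : Rel → ℕ
  relSrt : (r : Rel) → Fin (relArity r) → τ.Srt ⊕ Srt
  Fn : Type u
  fnArity : Fn → ℕ
  fnSrt : (f : Fn) → Fin (fnArity f) → τ.Srt ⊕ Srt
  fnCod : Fn → τ.Srt ⊕ Srt

/-- The extended vocabulary `τ' ⊇ τ`. -/
def MSExt.vocab {τ : MSVocab.{u}} (E : MSExt τ) : MSVocab.{u} where
  Srt := τ.Srt ⊕ E.Srt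
  Rel := τ.Rel ⊕ E.Rel
  relArity := Sum.elim τ.relArity E.relArity
  relSrt
    | .inl r => fun i => .inl (τ.relSrt r i)
    | .inr r => E.relSrt r
  Fn := τ.Fn ⊕ E.Fn
  fnArity := Sum.elim τ.fnArity E.fnArity
  fnSrt
    | .inl f => fun i => .inl (τ.fnSrt f i)
    | .inr f => E.fnSrt f
  fnCod
    | .inl f => .inl (τ.fnCod f)
    | .inr f => E.fnCod f

/-- The reduct of a `τ'`-structure to `τ`: the domains of the sorts of `τ`, with the
interpretations of the symbols of `τ`. -/
def MSStruct.reduct {τ : MSVocab.{u}} {E : MSExt τ} (M : MSStruct E.vocab) : MSStruct τ where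
  Dom s := M.Dom (.inl s)
  nonempty s := M.nonempty (.inl s)
  rel r := M.rel (.inl r)
  fn f := M.fn (.inl f)

/-- `K` is `Σ^B`-axiomatisable in first-order logic: it is a bounded projection of the class of
models of a first-order sentence in an extended vocabulary. -/
def IsSigmaBAxiomatisable {τ : MSVocab.{u}} (K : Set (MSStruct τ)) : Prop :=
  ∃ (E : MSExt τ) (φ : MSFormula E.vocab),
    K = {A | ∃ B : MSStruct E.vocab, B.Models φ ∧ A = B.reduct} ∧
    ∀ A : MSStruct τ, ∃ lam : Cardinal.{u}, ∀ B : MSStruct E.vocab,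
      B.Models φ → A = B.reduct → B.card ≤ lam

inductive TwoSorts : Type u
  | A
  | B

/-- The vocabulary with two sorts and no symbols; its structures are the pairs `(A, B)`. -/
def twoSorted : MSVocab.{u} where
  Srt := TwoSorts
  Rel := PEmpty
  relArity := PEmpty.elim
  relSrt r := r.elim
  Fn := PEmpty
  fnArity := PEmpty.elim
  fnSrt f := f.elim
  fnCod := PEmpty.elim

/-- `F` is definably bounding: it is non-decreasing and the class of all `(A, B)` with
`|B| ≤ F (|A|)` is `Σ^B`-axiomatisable in first-order logic. -/
def IsDefinablyBounding (F : Cardinal.{u} → Cardinal.{u}) : Prop :=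
  Monotone F ∧
    IsSigmaBAxiomatisable {M : MSStruct twoSorted.{u} | #(M.Dom .B) ≤ F #(M.Dom .A)}

/-! ## Bounded formulas of set theory -/

/-- The `Δ₀` formulas of the language of set theory with additional predicate symbols `P` of
arities `ar`, with free variables among `0, …, k - 1`. In `ball i φ`, i.e. `∀ z ∈ xᵢ, φ`, the
bound variable `z` becomes variable `0` of `φ` and all others are shifted by one. -/
inductive DeltaZero (P : Type) (ar : P → ℕ) : ℕ → Type
  | mem {k : ℕ} (i j : Fin k) : DeltaZero P ar k
  | eq {k : ℕ} (i j : Fin k) : DeltaZero P ar k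
  | pred {k : ℕ} (p : P) (t : Fin (ar p) → Fin k) : DeltaZero P ar k
  | neg {k : ℕ} (φ : DeltaZero P ar k) : DeltaZero P ar k
  | and {k : ℕ} (φ ψ : DeltaZero P ar k) : DeltaZero P ar k
  | ball {k : ℕ} (i : Fin k) (φ : DeltaZero P ar (k + 1)) : DeltaZero P ar k

/-- Truth of a `Δ₀` formula in the universe of sets, where `I` interprets the additional
predicate symbols and `v` the free variables. -/
def DeltaZero.Holds {P : Type} {ar : P → ℕ} (I : (p : P) → (Fin (ar p) → ZFSet.{u}) → Prop) :
    {k : ℕ} → DeltaZero P ar k → (Fin k → ZFSet.{u}) → Prop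
  | _, .mem i j, v => v i ∈ v j
  | _, .eq i j, v => v i = v j
  | _, .pred p t, v => I p fun i => v (t i)
  | _, .neg φ, v => ¬ φ.Holds I v
  | _, .and φ ψ, v => φ.Holds I v ∧ ψ.Holds I v
  | _, .ball i φ, v => ∀ z ∈ v i, φ.Holds I (Matrix.vecCons z v)

/-- The `Δ₀` formulas of the pure language of set theory. -/
abbrev PureDeltaZero (k : ℕ) : Type := DeltaZero Empty Empty.elim k

def PureDeltaZero.Holds {k : ℕ} (φ : PureDeltaZero k) (v : Fin k → ZFSet.{u}) : Prop :=
  DeltaZero.Holds (fun p => p.elim) φ v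

/-- The `Δ₀(R)` formulas: one additional `n`-ary predicate symbol, standing for `R`. -/
abbrev DeltaZeroIn (n k : ℕ) : Type := DeltaZero Unit (fun _ => n) k

def DeltaZeroIn.Holds {n k : ℕ} (R : (Fin n → ZFSet.{u}) → Prop) (φ : DeltaZeroIn n k)
    (v : Fin k → ZFSet.{u}) : Prop :=
  DeltaZero.Holds (fun _ => R) φ v

/-- `R` is a `Π₁` predicate: `R(x) ↔ ∀ w, θ(w, x)` for a `Δ₀` formula `θ` without parameters. -/
def IsPiOne {n : ℕ} (R : (Fin n → ZFSet.{u}) → Prop) : Prop :=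
  ∃ θ : PureDeltaZero (n + 1), ∀ x, R x ↔ ∀ w : ZFSet.{u}, θ.Holds (Matrix.vecCons w x)

/-- The binary predicate `y = ℘(x)`. -/
def PwSt (x : Fin 2 → ZFSet.{u}) : Prop := x 1 = (x 0).powerset

/-! ## Hereditary cardinality and the bounded class `Σ₁^F(R)` -/

/-- The transitive closure of a set: the least transitive set that includes it. -/
noncomputable def trcl (x : ZFSet.{u}) : ZFSet.{u} :=
  (ZFSet.vonNeumann x.rank).sep fun z => ∀ t : ZFSet.{u}, t.IsTransitive → x ⊆ t → z ∈ t

theorem subset_trcl (x : ZFSet.{u}) : x ⊆ trcl x := fun _ hz =>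
  ZFSet.mem_sep.2 ⟨ZFSet.subset_vonNeumann_self x hz, fun _ _ h => h hz⟩

theorem trcl_subset {x t : ZFSet.{u}} (ht : t.IsTransitive) (h : x ⊆ t) : trcl x ⊆ t :=
  fun _ hz => (ZFSet.mem_sep.1 hz).2 t ht h

theorem isTransitive_trcl (x : ZFSet.{u}) : (trcl x).IsTransitive := by
  intro y hy _ hz
  obtain ⟨h1, h2⟩ := ZFSet.mem_sep.1 hy
  exact ZFSet.mem_sep.2 ⟨ZFSet.isTransitive_vonNeumann _ _ h1 hz,
    fun t ht hx => ht _ (h2 t ht hx) hz⟩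

/-- The class `H_κ` of sets whose transitive closure has fewer than `κ` elements. -/
def HSet (κ : Cardinal.{u}) : Set ZFSet.{u} := {x | (trcl x).card < κ}

/-- The `H`-rank of `x`: the least infinite `κ` with `x ∈ H_{κ⁺}`. -/
noncomputable def hRank (x : ZFSet.{u}) : Cardinal.{u} :=
  sInf {κ | ℵ₀ ≤ κ ∧ x ∈ HSet (Order.succ κ)}

theorem hRank_eq (x : ZFSet.{u}) : hRank x = max ℵ₀ (trcl x).card := by
  have : {κ | ℵ₀ ≤ κ ∧ x ∈ HSet (Order.succ κ)} = Set.Ici (max ℵ₀ (trcl x).card) := by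
    ext κ
    simp [HSet]
  rw [hRank, this, csInf_Ici]

/-- The property `φ` of sets is `Σ₁^F(R)`: for some `Δ₀(R)` formula `ψ`, `φ(x)` is equivalent
to `∃ y, ψ(x, y)`, and if `φ(x)` holds then there is a witness `y` with `ρ_H(y) ≤ F(ρ_H(x))`. -/
def IsSigmaOneBounded {n : ℕ} (F : Cardinal.{u} → Cardinal.{u}) (R : (Fin n → ZFSet.{u}) → Prop)
    (φ : ZFSet.{u} → Prop) : Prop :=
  ∃ ψ : DeltaZeroIn n 2,
    (∀ x, φ x ↔ ∃ y, ψ.Holds R ![x, y]) ∧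
    ∀ x, φ x → ∃ y, hRank y ≤ F (hRank x) ∧ ψ.Holds R ![x, y]

/-! Let `R` be `∀ w θ`, and let `y` witness `φ(x)` for a bounded formula `ψ` in `R`. The instances
of `R` that occur in `ψ(x, y)` have arguments in any transitive set `A` containing `x` and `y`. If
such an instance fails and `A` is infinite, it already fails at some `w` of hereditary cardinality
at most `|A|`: take an elementary submodel of size `|A|` of a transitive set containing `A` and a
counterexample, and collapse it; the collapse fixes `A` pointwise (`exists_witness_card_trcl_le`).
Hence `R` on `A` may be replaced by `∀ w ∈ M, θ` for every `M` containing all sets of hereditary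
cardinality at most `|A|`.

That `M` is this rich has to be expressed by a bounded formula with `PwSt`. The certificate is a
triple `(A, M, Q)` with `Q = ℘(M)`: quantifying over `Q` reaches every relation inside `M`, so one
can say that `M` contains the image of `A` under every function from a part of `A` to `M`. Induction
on `∈` then puts the required sets into `M` (`Certifies.mem_of_card_trcl_le`). Conversely, with `κ`
the larger of the hereditary ranks of `x` and `y`, the set `M = H_{κ⁺}` works, and the whole
certificate has hereditary cardinality at most `2 ^ 2 ^ κ` (`exists_certifies`).

Since the rank of `y` is at most `F` of that of `x`, two applications of `μ ↦ 2 ^ (μ * F μ)` bound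
the certificate. This operation preserves definable bounding (`IsDefinablyBounding.exp`): a set `B`
has at most that size iff it embeds in `℘(A × C)` for some `C` with `|C| ≤ F |A|`, and the embedding
is coded by an extensional relation on `A × C × B`. The resulting bound depends on `F` alone. -/

/-! ### Isomorphism invariance of many-sorted satisfaction -/

/-- The structure transported along bijections of its domains. -/
def MSStruct.transport {τ : MSVocab.{u}} (M : MSStruct τ) {D : τ.Srt → Type u}
    (e : ∀ s, D s ≃ M.Dom s) : MSStruct τ where
  Dom := D
  nonempty s := let ⟨a⟩ := M.nonempty s; ⟨(e s).symm a⟩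
  rel r ts := M.rel r fun i => e _ (ts i)
  fn f ts := (e _).symm (M.fn f fun i => e _ (ts i))

/-- The assignment in `M` that corresponds to one in a transport of `M`. -/
def MSStruct.ofTransport {τ : MSVocab.{u}} (M : MSStruct τ) {D : τ.Srt → Type u}
    (e : ∀ s, D s ≃ M.Dom s) (v : (M.transport e).Assignment) : M.Assignment :=
  fun p => e p.1 (v p)

theorem MSTerm.val_transport {τ : MSVocab.{u}} (M : MSStruct τ) {D : τ.Srt → Type u}
    (e : ∀ s, D s ≃ M.Dom s) (v : (M.transport e).Assignment) {s : τ.Srt} (t : MSTerm τ s) :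
    t.val M (M.ofTransport e v) = e s (t.val (M.transport e) v) := by
  induction t with
  | var s n => rfl
  | app f ts ih =>
    simp only [MSTerm.val]
    change _ = e _ ((e _).symm _)
    rw [Equiv.apply_symm_apply]
    exact congrArg _ (funext ih)

open Classical in
theorem MSFormula.sat_transport {τ : MSVocab.{u}} (M : MSStruct τ) {D : τ.Srt → Type u}
    (e : ∀ s, D s ≃ M.Dom s) (φ : MSFormula τ) (v : (M.transport e).Assignment) :
    φ.Sat (M.transport e) v ↔ φ.Sat M (M.ofTransport e v) := by
  induction φ generalizing v with
  | falsum => rfl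
  | eq s t₁ t₂ =>
    simp only [MSFormula.Sat, MSTerm.val_transport]
    exact (e s).injective.eq_iff.symm
  | rel r ts =>
    simp only [MSFormula.Sat, MSTerm.val_transport]
    rfl
  | imp φ ψ ih₁ ih₂ => exact imp_congr (ih₁ v) (ih₂ v)
  | all s n φ ih =>
    have hup : ∀ a : (M.transport e).Dom s, M.ofTransport e (Function.update v (s, n) a) =
        Function.update (M.ofTransport e v) (s, n) (e s a) := fun a => funext fun p =>
      Function.apply_update (fun p : τ.Srt × ℕ => e p.1) v (s, n) a p
    simp only [MSFormula.Sat]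
    refine (forall_congr' fun a => (ih _).trans (Iff.of_eq (congrArg _ (hup a)))).trans ?_
    exact ⟨fun h b => (e s).apply_symm_apply b ▸ h ((e s).symm b), fun h a => h (e s a)⟩

/-- Axiomatisability asks for equality of reducts, not isomorphism; transport replaces the domains
of a model by prescribed sets of the same size. -/
theorem MSStruct.models_transport {τ : MSVocab.{u}} {M : MSStruct τ} {D : τ.Srt → Type u}
    (e : ∀ s, D s ≃ M.Dom s) {φ : MSFormula τ} (h : M.Models φ) : (M.transport e).Models φ :=
  fun v => (φ.sat_transport M e v).2 (h _)

theorem MSStruct.card_transport {τ : MSVocab.{u}} (M : MSStruct τ) {D : τ.Srt → Type u}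
    (e : ∀ s, D s ≃ M.Dom s) : (M.transport e).card = M.card :=
  mk_congr (Equiv.sigmaCongrRight e)

theorem twoSorted_struct_ext {M N : MSStruct twoSorted.{u}} (h : M.Dom = N.Dom) : M = N := by
  cases M; cases N
  cases h
  congr
  · funext r; exact r.elim
  · funext r; exact r.elim

/-- The two-sorted structure `(X, Y)`. -/
def twoSortedStruct (X Y : Type u) [Nonempty X] [Nonempty Y] : MSStruct twoSorted.{u} where
  Dom | .A => X | .B => Y
  nonempty | .A => ‹_› | .B => ‹_›
  rel r := r.elim
  fn f := f.elim

/-! ### Adding exponentiation to a definably bounding function -/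

/-- The sorts of a vocabulary extending the two-sorted one, sent to those of the extended
vocabulary with one more sort: that sort takes the place of the second of the two sorts. -/
def expSrt {S : Type u} : TwoSorts.{u} ⊕ S → TwoSorts.{u} ⊕ Option S
  | .inl .A => .inl .A
  | .inl .B => .inr none
  | .inr s => .inr (some s)

/-- Distinct variables must stay distinct after translation, so that updating an assignment commutes
with restricting it. -/
theorem expSrt_injective {S : Type u} : Function.Injective (expSrt (S := S)) := by
  rintro ((_ | _) | _) ((_ | _) | _) h <;> simp_all [expSrt]

/-- The extension by one sort `C`, a relation on `A × C × B`, and the symbols of `E` with `C` in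
the place of `B`. -/
def expExt (E : MSExt twoSorted.{u}) : MSExt twoSorted.{u} where
  Srt := Option E.Srt
  Rel := Option E.Rel
  relArity r := r.elim 3 E.relArity
  relSrt
    | none => ![.inl .A, .inr none, .inl .B]
    | some r => fun i => expSrt (E.relSrt r i)
  Fn := E.Fn
  fnArity := E.fnArity
  fnSrt f i := expSrt (E.fnSrt f i)
  fnCod f := expSrt (E.fnCod f)

def MSTerm.toExp {E : MSExt twoSorted.{u}} :
    {s : E.vocab.Srt} → MSTerm E.vocab s → MSTerm (expExt E).vocab (expSrt s)
  | _, .var s n => .var (τ := (expExt E).vocab) (expSrt s) n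
  | _, @MSTerm.app _ (Sum.inl f) _ => PEmpty.elim f
  | _, @MSTerm.app _ (Sum.inr f) ts =>
    .app (τ := (expExt E).vocab) (Sum.inr f) fun i => (ts i).toExp

def MSFormula.toExp {E : MSExt twoSorted.{u}} : MSFormula E.vocab → MSFormula (expExt E).vocab
  | .falsum => .falsum
  | .eq s t₁ t₂ => .eq (τ := (expExt E).vocab) (expSrt s) t₁.toExp t₂.toExp
  | .rel (.inl r) _ => r.elim
  | .rel (.inr r) ts => .rel (τ := (expExt E).vocab) (.inr (some r)) fun i => (ts i).toExp
  | .imp φ ψ => .imp φ.toExp ψ.toExp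
  | .all s n φ => .all (τ := (expExt E).vocab) (expSrt s) n φ.toExp

/-- The structure for the original vocabulary inside one for the extended vocabulary. -/
def MSStruct.ofExp {E : MSExt twoSorted.{u}} (N : MSStruct (expExt E).vocab) :
    MSStruct E.vocab where
  Dom s := N.Dom (expSrt s)
  nonempty s := N.nonempty (expSrt s)
  rel
    | .inl r => r.elim
    | .inr r => N.rel (.inr (some r))
  fn
    | .inl f => f.elim
    | .inr f => N.fn (.inr f)

/-- The assignment in `N.ofExp` that is part of one in `N`. -/
def MSStruct.Assignment.ofExp {E : MSExt twoSorted.{u}} {N : MSStruct (expExt E).vocab}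
    (v : N.Assignment) : N.ofExp.Assignment :=
  fun p => v (expSrt p.1, p.2)

theorem MSTerm.val_toExp {E : MSExt twoSorted.{u}} (N : MSStruct (expExt E).vocab)
    (v : N.Assignment) {s : E.vocab.Srt} (t : MSTerm E.vocab s) :
    t.toExp.val N v = t.val N.ofExp v.ofExp := by
  induction t with
  | var s n => simp only [MSTerm.toExp, MSTerm.val]; rfl
  | app f ts ih =>
    cases f with
    | inl f => exact PEmpty.elim f
    | inr f =>
      simp only [MSTerm.toExp, MSTerm.val]
      exact congrArg (N.fn (.inr f)) (funext ih)

open Classical in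
theorem MSFormula.sat_toExp {E : MSExt twoSorted.{u}} (N : MSStruct (expExt E).vocab)
    (φ : MSFormula E.vocab) (v : N.Assignment) :
    φ.toExp.Sat N v ↔ φ.Sat N.ofExp v.ofExp := by
  induction φ generalizing v with
  | falsum => rfl
  | eq s t₁ t₂ => simp only [MSFormula.toExp, MSFormula.Sat, MSTerm.val_toExp]; rfl
  | rel r ts =>
    cases r with
    | inl r => exact PEmpty.elim r
    | inr r =>
      simp only [MSFormula.toExp, MSFormula.Sat]
      exact Iff.of_eq (congrArg (N.rel (.inr (some r))) (funext fun i => (ts i).val_toExp N v))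
  | imp φ ψ ih₁ ih₂ => exact imp_congr (ih₁ v) (ih₂ v)
  | all s n φ ih =>
    simp only [MSFormula.toExp, MSFormula.Sat]
    refine forall_congr' fun a => (ih _).trans (Iff.of_eq (congrArg _ ?_))
    exact Function.update_comp_eq_of_injective' v
      (f := fun p : E.vocab.Srt × ℕ => ((expSrt p.1, p.2) : (expExt E).vocab.Srt × ℕ))
      (fun p q h => Prod.ext (expSrt_injective (Prod.mk.inj h).1) (Prod.mk.inj h).2) (s, n) a

-- Sentences are universal closures, so every assignment in `N.ofExp` must extend to one in `N`. The
-- only sort outside the range of `expSrt` is the new `B`, whose variables get arbitrary values.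
open Classical in
theorem MSStruct.models_toExp {E : MSExt twoSorted.{u}} (N : MSStruct (expExt E).vocab)
    (φ : MSFormula E.vocab) : N.Models φ.toExp ↔ N.ofExp.Models φ := by
  constructor
  · intro h v
    obtain ⟨w, hw⟩ : ∃ w : N.Assignment, w.ofExp = v := by
      have hw : ∀ p : (expExt E).vocab.Srt × ℕ, ∃ a : N.Dom p.1,
          ∀ (s : E.vocab.Srt) (hs : expSrt s = p.1), a = hs ▸ v (s, p.2) := by
        rintro ⟨t, n⟩
        by_cases ht : ∃ s : E.vocab.Srt, expSrt s = t
        · obtain ⟨s, rfl⟩ := ht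
          refine ⟨v (s, n), fun s' hs' => ?_⟩
          obtain rfl := expSrt_injective hs'
          rfl
        · exact ⟨(N.nonempty t).some, fun s hs => absurd ⟨s, hs⟩ ht⟩
      choose w hw using hw
      exact ⟨w, funext fun p => hw (expSrt p.1, p.2) p.1 rfl⟩
    exact hw ▸ (φ.sat_toExp N w).1 (h w)
  · exact fun h v => (φ.sat_toExp N v).2 (h _)

/-- The formula that expresses `φ ∧ ψ`. -/
def MSFormula.conj {τ : MSVocab.{u}} (φ ψ : MSFormula τ) : MSFormula τ :=
  .imp (.imp φ (.imp ψ .falsum)) .falsum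

theorem MSStruct.models_conj {τ : MSVocab.{u}} (M : MSStruct τ) (φ ψ : MSFormula τ) :
    M.Models (φ.conj ψ) ↔ M.Models φ ∧ M.Models ψ := by
  simp only [MSStruct.Models, MSFormula.conj, MSFormula.Sat, ← forall_and]
  exact forall_congr' fun v => by tauto

/-- The atomic formula `e(a, c, bₙ)`. -/
def expAtom (E : MSExt twoSorted.{u}) (n : ℕ) : MSFormula (expExt E).vocab :=
  .rel (τ := (expExt E).vocab) (.inr none) fun
    | (0 : Fin 3) => .var (τ := (expExt E).vocab) (.inl .A) 0
    | (1 : Fin 3) => .var (τ := (expExt E).vocab) (.inr none) 0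
    | (2 : Fin 3) => .var (τ := (expExt E).vocab) (.inl .B) n

/-- The formula expressing that elements of `B` related to the same pairs are equal. -/
def expExtensionality (E : MSExt twoSorted.{u}) : MSFormula (expExt E).vocab :=
  let sub (m n : ℕ) : MSFormula (expExt E).vocab :=
    .all (τ := (expExt E).vocab) (.inl .A) 0 <| .all (τ := (expExt E).vocab) (.inr none) 0 <|
      .imp (expAtom E m) (expAtom E n)
  .imp (sub 0 1) <| .imp (sub 1 0) <|
    .eq (τ := (expExt E).vocab) (.inl .B) (.var (τ := (expExt E).vocab) (.inl .B) 0)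
      (.var (τ := (expExt E).vocab) (.inl .B) 1)

/-- The interpretation of the additional relation. -/
def MSStruct.expRel {E : MSExt twoSorted.{u}} (N : MSStruct (expExt E).vocab)
    (a : N.Dom (.inl .A)) (c : N.Dom (.inr none)) (b : N.Dom (.inl .B)) : Prop :=
  N.rel (.inr none) fun
    | (0 : Fin 3) => a
    | (1 : Fin 3) => c
    | (2 : Fin 3) => b

theorem sat_expAtom {E : MSExt twoSorted.{u}} (N : MSStruct (expExt E).vocab) (n : ℕ)
    (v : N.Assignment) : (expAtom E n).Sat N v ↔
      N.expRel (v (.inl .A, 0)) (v (.inr none, 0)) (v (.inl .B, n)) := by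
  simp only [expAtom, MSFormula.Sat, MSStruct.expRel]
  refine Iff.of_eq (congrArg (N.rel (.inr none)) (funext fun i => ?_))
  match i with
  | (0 : Fin 3) => rfl
  | (1 : Fin 3) => rfl
  | (2 : Fin 3) => rfl

-- The two free variables of sort `B` are universally closed; the condition says that `B` injects
-- into the power set of `A × C`.
open Classical in
theorem models_expExtensionality {E : MSExt twoSorted.{u}} (N : MSStruct (expExt E).vocab) :
    N.Models (expExtensionality E) ↔ ∀ b b' : N.Dom (.inl .B),
      (∀ a c, N.expRel a c b → N.expRel a c b') → (∀ a c, N.expRel a c b' → N.expRel a c b) →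
        b = b' := by
  have upd : ∀ (v : N.Assignment) (a : N.Dom (.inl .A)) (c : N.Dom (.inr none)) (n : ℕ),
      (expAtom E n).Sat N (Function.update (Function.update v (Sum.inl .A, 0) a)
        (Sum.inr none, 0) c) ↔ N.expRel a c (v (.inl .B, n)) := by
    intro v a c n
    rw [sat_expAtom, Function.update_of_ne, Function.update_self, Function.update_self,
      Function.update_of_ne, Function.update_of_ne]
    all_goals intro h; cases h
  simp only [MSStruct.Models, expExtensionality, MSFormula.Sat, upd]
  constructor
  · intro h b b'
    let v : N.Assignment := fun p => (N.nonempty p.1).some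
    have := h (Function.update (Function.update v (Sum.inl .B, 0) b) (Sum.inl .B, 1) b')
    simp only [MSTerm.val] at this
    rwa [Function.update_self, Function.update_of_ne (fun h => by cases h), Function.update_self]
      at this
  · exact fun h v => h _ _

/-- `μ ↦ 2 ^ (μ * F μ)`, except that it is `0` where `F` is. -/
noncomputable def expBound (F : Cardinal.{u} → Cardinal.{u}) (μ : Cardinal.{u}) : Cardinal.{u} :=
  open Classical in if F μ = 0 then 0 else 2 ^ (μ * F μ)

theorem expBound_mono {F : Cardinal.{u} → Cardinal.{u}} (hF : Monotone F) :
    Monotone (expBound F) := by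
  intro μ ν h
  unfold expBound
  split_ifs with h₁ h₂ h₂
  · exact le_rfl
  · exact zero_le
  · exact absurd (le_antisymm (h₂ ▸ hF h) zero_le) h₁
  · exact power_le_power_left two_ne_zero (mul_le_mul' h (hF h))

/-- A structure for `expExt E` made from a structure for `E`. -/
def MSStruct.toExp {E : MSExt twoSorted.{u}} (M : MSStruct E.vocab) (N : MSStruct twoSorted.{u})
    (e : N.Dom .A ≃ M.Dom (.inl .A)) (R : N.Dom .A → M.Dom (.inl .B) → N.Dom .B → Prop) :
    MSStruct (expExt E).vocab :=
  -- The two original sorts carry literally the domains of `N`, so that the reduct is `N` by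
  -- definition; the old second domain of `M` becomes the sort `C`.
  let D : TwoSorts.{u} ⊕ Option E.Srt → Type u
    | .inl s => N.Dom s
    | .inr none => M.Dom (.inl .B)
    | .inr (some s) => M.Dom (.inr s)
  let M' : MSStruct E.vocab := M.transport (D := fun s => D (expSrt s)) fun
    | .inl .A => e
    | .inl .B => .refl _
    | .inr _ => .refl _
  { Dom := D
    nonempty := fun
      | .inl s => N.nonempty s
      | .inr none => M.nonempty (.inl .B)
      | .inr (some s) => M.nonempty (.inr s)
    rel := fun
      | .inl r => N.rel r
      | .inr none => fun x => R (x (0 : Fin 3)) (x (1 : Fin 3)) (x (2 : Fin 3))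
      | .inr (some r) => M'.rel (.inr r)
    fn := fun
      | .inl f => N.fn f
      | .inr f => M'.fn (.inr f) }

theorem MSStruct.models_ofExp_toExp {E : MSExt twoSorted.{u}} {M : MSStruct E.vocab}
    (N : MSStruct twoSorted.{u}) (e : N.Dom .A ≃ M.Dom (.inl .A))
    (R : N.Dom .A → M.Dom (.inl .B) → N.Dom .B → Prop) {φ : MSFormula E.vocab}
    (h : M.Models φ) : (M.toExp N e R).ofExp.Models φ := by
  have := MSStruct.models_transport (D := (M.toExp N e R).ofExp.Dom) (fun
    | .inl .A => e
    | .inl .B => .refl _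
    | .inr _ => .refl _) h
  convert this using 1
  unfold MSStruct.ofExp MSStruct.transport
  congr 1
  · funext r
    rcases r with r | r
    · exact PEmpty.elim r
    · rfl
  · funext r
    rcases r with r | r
    · exact PEmpty.elim r
    · rfl

/-- The class is axiomatised by the old sentence for `(A, C)` together with extensionality of the
relation on `A × C × B`. -/
theorem IsDefinablyBounding.exp {F : Cardinal.{u} → Cardinal.{u}} (hF : IsDefinablyBounding F) :
    IsDefinablyBounding (expBound F) := by
  obtain ⟨hmono, E, φ, hK, hbd⟩ := hF
  refine ⟨expBound_mono hmono, expExt E, φ.toExp.conj (expExtensionality E), ?_, ?_⟩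
  · ext N
    simp only [Set.mem_ofPred_eq, MSStruct.models_conj, MSStruct.models_toExp,
      models_expExtensionality]
    constructor
    · intro hN
      -- Domains are nonempty, so where `F` is `0` no `C` exists and the new bound has to be `0`
      -- too.
      have hF0 : F #(N.Dom .A) ≠ 0 := by
        intro h0
        have := N.nonempty .B
        simp [expBound, h0, mk_ne_zero] at hN
      rw [expBound, if_neg hF0] at hN
      have := N.nonempty .A
      have : Nonempty (F #(N.Dom .A)).out := by rwa [← mk_ne_zero_iff, mk_out]
      -- Choosing `C` of the largest admissible size `F |A|` leaves room for every `B` in the class.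
      have hmem : twoSortedStruct (N.Dom .A) (F #(N.Dom .A)).out ∈
          {M : MSStruct twoSorted.{u} | #(M.Dom .B) ≤ F #(M.Dom .A)} := (mk_out _).le
      rw [hK] at hmem
      obtain ⟨M, hM, hMr⟩ := hmem
      have hA : N.Dom .A = M.Dom (.inl .A) := congrArg (fun S : MSStruct twoSorted.{u} => S.Dom TwoSorts.A) hMr
      have hC : (F #(N.Dom .A)).out = M.Dom (.inl .B) := congrArg (fun S : MSStruct twoSorted.{u} => S.Dom TwoSorts.B) hMr
      have hC' : #(M.Dom (.inl .B)) = F #(N.Dom .A) := hC ▸ mk_out _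
      have hle : #(N.Dom .B) ≤ #(Set (N.Dom .A × M.Dom (.inl .B))) := by
        rwa [mk_set, mk_prod, lift_id, lift_id, hC']
      obtain ⟨g⟩ := hle
      refine ⟨M.toExp N (.cast hA) fun a c b => (a, c) ∈ g b,
        ⟨MSStruct.models_ofExp_toExp N _ _ hM, fun b b' h h' => ?_⟩, rfl⟩
      exact g.injective (Set.ext fun p => ⟨h p.1 p.2, h' p.1 p.2⟩)
    · rintro ⟨M, ⟨hM, hext⟩, rfl⟩
      have hmem : M.ofExp.reduct ∈ {A | ∃ B : MSStruct E.vocab, B.Models φ ∧ A = B.reduct} :=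
        ⟨_, hM, rfl⟩
      rw [← hK] at hmem
      have hC : #(M.Dom (.inr none)) ≤ F #(M.Dom (.inl .A)) := hmem
      have hF0 : F #(M.Dom (.inl .A)) ≠ 0 := by
        intro h0
        have := M.nonempty (.inr none)
        rw [h0] at hC
        simp [mk_ne_zero] at hC
      change #(M.Dom (.inl .B)) ≤ expBound F #(M.Dom (.inl .A))
      rw [expBound, if_neg hF0]
      calc #(M.Dom (.inl .B)) ≤ #(Set (M.Dom (.inl .A) × M.Dom (.inr none))) := by
            refine mk_le_of_injective
              (f := fun b => {p | M.expRel p.1 p.2 b}) fun b b' h => hext b b' ?_ ?_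
            · exact fun a c hac => (Set.ext_iff.1 h (a, c)).1 hac
            · exact fun a c hac => (Set.ext_iff.1 h (a, c)).2 hac
        _ ≤ _ := by
            rw [mk_set, mk_prod, lift_id, lift_id]
            exact power_le_power_left two_ne_zero (mul_le_mul' le_rfl hC)
  · intro N
    choose lam hlam using hbd
    have := N.nonempty .A
    -- The sort `C` is not part of the reduct, so the old bounds form a family indexed by the
    -- possible `C`. One representative for each cardinal up to `F |A|` suffices, which makes the
    -- supremum exist; the value `0` at an empty representative is never used.
    let bound : Set.Iic (F #(N.Dom .A)) → Cardinal.{u} := fun c =>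
      open Classical in if h : Nonempty c.1.out then lam (twoSortedStruct (N.Dom .A) c.1.out) else 0
    have hbdd : BddAbove (Set.range bound) := bddAbove_of_small
    refine ⟨#(N.Dom .B) + ⨆ c, bound c, fun M hM hN => ?_⟩
    rw [MSStruct.models_conj, MSStruct.models_toExp] at hM
    subst hN
    have hmem : M.ofExp.reduct ∈ {A | ∃ B : MSStruct E.vocab, B.Models φ ∧ A = B.reduct} :=
      ⟨_, hM.1, rfl⟩
    rw [← hK] at hmem
    have hC : #(M.Dom (.inr none)) ≤ F #(M.Dom (.inl .A)) := hmem
    let c : Set.Iic (F #(M.Dom (.inl .A))) := ⟨_, Set.mem_Iic.2 hC⟩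
    obtain ⟨eC⟩ : Nonempty (c.1.out ≃ M.Dom (.inr none)) := Cardinal.eq.1 (mk_out _)
    have hne : Nonempty c.1.out := eC.nonempty_congr.2 (M.nonempty _)
    -- Transport along `eC` gives the model the chosen representative as its domain `C`, so that the
    -- bound `lam` for that representative applies.
    let D : E.vocab.Srt → Type u
      | .inl .A => M.Dom (.inl .A)
      | .inl .B => c.1.out
      | .inr s => M.Dom (.inr (some s))
    let e : ∀ s, D s ≃ M.ofExp.Dom s
      | .inl .A => .refl _
      | .inl .B => eC
      | .inr _ => .refl _
    have hcard : M.ofExp.card ≤ bound c := by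
      rw [← M.ofExp.card_transport e]
      simp only [bound, dif_pos hne]
      refine hlam _ _ (MSStruct.models_transport e hM.1) (twoSorted_struct_ext (funext fun s => ?_))
      cases s <;> rfl
    have hsup : bound c ≤ ⨆ c, bound c := le_ciSup hbdd c
    refine le_trans ?_ (add_le_add le_rfl (hcard.trans hsup))
    change _ ≤ #(M.Dom (.inl .B)) + #(Σ s, M.Dom (expSrt s))
    rw [add_def]
    refine mk_le_of_surjective (f := fun
      | .inl b => ⟨.inl .B, b⟩
      | .inr ⟨s, x⟩ => ⟨expSrt s, x⟩) ?_
    rintro ⟨(_ | _) | _ | s, x⟩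
    · exact ⟨.inr ⟨.inl .A, x⟩, rfl⟩
    · exact ⟨.inl x, rfl⟩
    · exact ⟨.inr ⟨.inl .B, x⟩, rfl⟩
    · exact ⟨.inr ⟨.inr s, x⟩, rfl⟩

/-! ### Mostowski collapse of a class of sets -/

theorem small_mem_and (S : Set ZFSet.{u}) (x : ZFSet.{u}) : Small.{u} {y // y ∈ x ∧ y ∈ S} :=
  small_of_injective (β := x) (f := fun y => ⟨y.1, y.2.1⟩) fun _ _ h =>
    Subtype.ext (congrArg (fun y : x => y.1) h)

/-- The Mostowski collapse of the membership relation restricted to `S`. -/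
noncomputable def collapse (S : Set ZFSet.{u}) (x : ZFSet.{u}) : ZFSet.{u} :=
  have := small_mem_and S x
  ZFSet.range fun y : {y // y ∈ x ∧ y ∈ S} => collapse S y.1
termination_by x
decreasing_by exact y.2.1

theorem mem_collapse {S : Set ZFSet.{u}} {x z : ZFSet.{u}} :
    z ∈ collapse S x ↔ ∃ y ∈ x, y ∈ S ∧ collapse S y = z := by
  rw [collapse]
  have := small_mem_and S x
  simp [ZFSet.mem_range, and_assoc]

/-- Extensionality of `S` is all that is needed; well-foundedness comes from membership itself. -/
theorem collapse_injOn {S : Set ZFSet.{u}}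
    (hS : ∀ x ∈ S, ∀ y ∈ S, (∀ z ∈ S, z ∈ x ↔ z ∈ y) → x = y) : Set.InjOn (collapse S) S := by
  intro x
  induction x using ZFSet.inductionOn with
  | h x ih =>
    intro hx y hy hxy
    refine hS x hx y hy fun z hz => ⟨fun h => ?_, fun h => ?_⟩
    · obtain ⟨z', h', hz', he⟩ := mem_collapse.1 (hxy ▸ mem_collapse.2 ⟨z, h, hz, rfl⟩)
      rwa [ih z h hz hz' he.symm]
    · obtain ⟨z', h', hz', he⟩ := mem_collapse.1 (hxy.symm ▸ mem_collapse.2 ⟨z, h, hz, rfl⟩)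
      rwa [← ih z' h' hz' hz he]

theorem collapse_eq_self {S : Set ZFSet.{u}} {A : ZFSet.{u}} (hA : A.IsTransitive)
    (hAS : ∀ a ∈ A, a ∈ S) {a : ZFSet.{u}} (ha : a ∈ A) : collapse S a = a := by
  induction a using ZFSet.inductionOn with
  | h a ih =>
    ext z
    rw [mem_collapse]
    constructor
    · rintro ⟨y, hy, -, rfl⟩
      rwa [ih y hy (hA.subset_of_mem ha hy)]
    · exact fun hz => ⟨z, hz, hAS z (hA.subset_of_mem ha hz), ih z hz (hA.subset_of_mem ha hz)⟩

/-! ### Bounded formulas as first-order formulas with one binary relation -/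

open FirstOrder FirstOrder.Language

/-- The first-order formula with the bounded quantifiers spelled out. -/
def DeltaZero.toFirstOrder {k : ℕ} (φ : PureDeltaZero k) {m : ℕ} (ρ : Fin k → Fin m) :
    Language.graph.BoundedFormula Empty m :=
  match φ with
  | .mem i j => adj.boundedFormula₂ (&(ρ i)) (&(ρ j))
  | .eq i j => (&(ρ i)).bdEqual (&(ρ j))
  | .pred p _ => p.elim
  | .neg φ => (toFirstOrder φ ρ).not
  | .and φ ψ => (toFirstOrder φ ρ) ⊓ (toFirstOrder ψ ρ)
  | .ball i φ => ((adj.boundedFormula₂ (&(Fin.last m)) (&(ρ i).castSucc)).imp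
      (toFirstOrder φ (Matrix.vecCons (Fin.last m) (Fin.castSucc ∘ ρ)))).all

/-- The condition on `π` says that it is an isomorphism onto a transitive class, where bounded
formulas are absolute. It covers both the inclusion of a transitive set and a Mostowski collapse. -/
theorem DeltaZero.realize_toFirstOrder {X : Type*} [Language.graph.Structure X]
    {π : X → ZFSet.{u}} (hinj : Function.Injective π)
    (hπ : ∀ x z, z ∈ π x ↔ ∃ y, Structure.RelMap adj ![y, x] ∧ π y = z) {k : ℕ}
    (φ : PureDeltaZero k) {m : ℕ} (ρ : Fin k → Fin m) (xs : Fin m → X) :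
    (toFirstOrder φ ρ).Realize default xs ↔ φ.Holds (π ∘ xs ∘ ρ) := by
  induction φ generalizing m with
  | mem i j =>
    simp [toFirstOrder, PureDeltaZero.Holds, DeltaZero.Holds, hπ, BoundedFormula.realize_rel₂,
      hinj.eq_iff]
  | eq i j =>
    simp [toFirstOrder, PureDeltaZero.Holds, DeltaZero.Holds, hinj.eq_iff]
  | pred p _ => exact p.elim
  | neg φ ih =>
    simp only [toFirstOrder, BoundedFormula.realize_not, ih]
    rfl
  | and φ ψ ih₁ ih₂ =>
    simp only [toFirstOrder, BoundedFormula.realize_inf, ih₁, ih₂]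
    rfl
  | ball i φ ih =>
    simp only [toFirstOrder, BoundedFormula.realize_all, BoundedFormula.realize_imp, ih,
      BoundedFormula.realize_rel₂]
    have key : ∀ a : X, π ∘ Fin.snoc xs a ∘ Matrix.vecCons (Fin.last m) (Fin.castSucc ∘ ρ) =
        Matrix.vecCons (π a) (π ∘ xs ∘ ρ) := by
      intro a
      funext j
      refine Fin.cases ?_ (fun j => ?_) j <;> simp
    simp only [PureDeltaZero.Holds, DeltaZero.Holds, Function.comp_apply, hπ]
    constructor
    · rintro h z ⟨a, ha, rfl⟩
      have := h a (by simpa using ha)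
      rwa [key] at this
    · intro h a ha
      have := h (π a) ⟨a, by simpa using ha, rfl⟩
      rwa [key]

/-! ### Small witnesses for bounded formulas -/

/-- Downward Löwenheim–Skolem inside a transitive set containing `w` and `A`, followed by the
Mostowski collapse. The transitive `A` lies in the submodel and is fixed pointwise, so the
parameters do not move, while `w` moves to a set whose transitive closure lies in the collapsed
submodel. -/
theorem exists_witness_card_trcl_le {n : ℕ} (θ : PureDeltaZero (n + 1)) {A : ZFSet.{u}}
    (hA : A.IsTransitive) (hinf : ℵ₀ ≤ A.card) {x : Fin n → ZFSet.{u}} (hx : ∀ i, x i ∈ A)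
    {w : ZFSet.{u}} (hw : θ.Holds (Matrix.vecCons w x)) :
    ∃ w', (trcl w').card ≤ A.card ∧ θ.Holds (Matrix.vecCons w' x) := by
  let T := trcl (insert w A)
  have hT : T.IsTransitive := isTransitive_trcl _
  have hwT : w ∈ T := subset_trcl _ (by simp)
  have hAT : A ⊆ T := fun a ha => subset_trcl _ (by simp [ha])
  let X := {a // a ∈ T}
  let _ : Language.graph.Structure X :=
    { funMap := fun f => f.elim
      RelMap := fun | .adj => fun v => (v 0).1 ∈ (v 1).1 }
  have hX : ∀ (x : X) z, z ∈ x.1 ↔ ∃ y : X, Structure.RelMap adj ![y, x] ∧ y.1 = z := by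
    intro x z
    constructor
    · exact fun hz => ⟨⟨z, hT.subset_of_mem x.2 hz⟩, hz, rfl⟩
    · rintro ⟨y, hy, rfl⟩
      exact hy
  let s : Set X := {a | a.1 ∈ A}
  have hs : #s = lift.{u + 1} A.card := by
    rw [← ZFSet.cardinalMk_coe_sort]
    exact mk_congr
      ⟨fun a => ⟨a.1.1, a.2⟩, fun a => ⟨⟨a.1, hAT a.2⟩, a.2⟩, fun _ => rfl, fun _ => rfl⟩
  have hs' : #(s ∪ {⟨w, hwT⟩} : Set X) ≤ lift.{u + 1} A.card :=
    (mk_union_le _ _).trans (add_le_of_le (aleph0_le_lift.2 hinf) hs.le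
      ((mk_singleton _).le.trans (one_le_aleph0.trans (aleph0_le_lift.2 hinf))))
  have hlang : Language.graph.card ≤ ℵ₀ := by
    have : Countable Language.graph.Symbols := by
      have (l : ℕ) : Countable (Language.graph.Functions l) := inferInstanceAs (Countable Empty)
      have (l : ℕ) : Countable (Language.graph.Relations l) := Finite.to_countable
      exact inferInstanceAs (Countable ((Σ l, _) ⊕ (Σ l, _)))
    exact mk_le_aleph0
  obtain ⟨S, hsS, hS⟩ := exists_elementarySubstructure_card_eq Language.graph
    (s ∪ {⟨w, hwT⟩}) A.card hinf (by rwa [lift_id'.{u, u + 1}])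
    
    ((lift_le.2 hlang).trans (by simpa using hinf))
    (by rw [lift_id'.{u, u + 1}, ← hs]; exact mk_set_le s)
  have hval : ∀ {m : ℕ} (ψ : PureDeltaZero m) (v : Fin m → S),
      (ψ.toFirstOrder id).Realize default v ↔ ψ.Holds (fun i => (v i).1.1) := by
    intro m ψ v
    rw [← S.subtype.map_boundedFormula, Unique.eq_default (_ ∘ default),
      DeltaZero.realize_toFirstOrder Subtype.val_injective hX]
    rfl
  let S' : Set ZFSet.{u} := {a | ∃ b : S, b.1.1 = a}
  have hrelS : ∀ {a b : S}, Structure.RelMap adj ![a, b] ↔ a.1.1 ∈ b.1.1 := Iff.rfl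
  -- The submodel is extensional because inclusion is a bounded formula: an inclusion that holds as
  -- seen from the submodel is, by elementarity, a true inclusion.
  have hext : ∀ x ∈ S', ∀ y ∈ S', (∀ z ∈ S', z ∈ x ↔ z ∈ y) → x = y := by
    have key : ∀ a b : S, (∀ c : S, c.1.1 ∈ a.1.1 → c.1.1 ∈ b.1.1) → a.1.1 ⊆ b.1.1 := by
      intro a b h
      -- Variable `2` is the second parameter, shifted past the bound variable.
      have := (hval (.ball 0 (.mem 0 2)) ![a, b]).1 (by
        simpa [DeltaZero.toFirstOrder, BoundedFormula.realize_rel₂, hrelS, Fin.snoc] using h)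
      exact this
    rintro _ ⟨a, rfl⟩ _ ⟨b, rfl⟩ h
    exact ZFSet.ext fun z => ⟨fun hz => key a b (fun c => (h _ ⟨c, rfl⟩).1) hz,
      fun hz => key b a (fun c => (h _ ⟨c, rfl⟩).2) hz⟩
  let π : S → ZFSet.{u} := fun a => collapse S' a.1.1
  have hinj : Function.Injective π := fun a b h =>
    Subtype.ext (Subtype.ext (collapse_injOn hext ⟨a, rfl⟩ ⟨b, rfl⟩ h))
  have hπ : ∀ (a : S) z, z ∈ π a ↔ ∃ b : S, Structure.RelMap adj ![b, a] ∧ π b = z := by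
    intro a z
    rw [mem_collapse]
    constructor
    · rintro ⟨_, hy, ⟨b, rfl⟩, rfl⟩
      exact ⟨b, hy, rfl⟩
    · rintro ⟨b, hb, rfl⟩
      exact ⟨_, hb, ⟨b, rfl⟩, rfl⟩
  have hAS : ∀ a ∈ A, ∃ b : S, b.1.1 = a :=
    fun a ha => ⟨⟨⟨a, hAT ha⟩, hsS (.inl ha)⟩, rfl⟩
  have hfix : ∀ a ∈ A, collapse S' a = a := fun a ha => collapse_eq_self hA hAS ha
  choose xs hxs using fun i => hAS (x i) (hx i)
  let w₀ : S := ⟨⟨w, hwT⟩, hsS (.inr rfl)⟩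
  have hsmall : Small.{u} S := by
    have : Small.{u} X := ZFSet.small_coe T
    exact small_subtype _ _
  refine ⟨π w₀, ?_, ?_⟩
  · have hC : (ZFSet.range π).card ≤ A.card := by
      have := ZFSet.lift_card_range_le (f := π)
      rw [← lift_le.{u + 1}]
      exact this.trans hS.le
    refine le_trans (ZFSet.card_mono (trcl_subset ?_ ?_)) hC
    · intro y hy z hz
      obtain ⟨a, rfl⟩ := ZFSet.mem_range.1 hy
      obtain ⟨b, -, rfl⟩ := (hπ a z).1 hz
      exact ZFSet.mem_range_self b
    · intro z hz
      obtain ⟨b, -, rfl⟩ := (hπ w₀ z).1 hz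
      exact ZFSet.mem_range_self b
  · have h₁ := (hval θ (Matrix.vecCons w₀ xs)).2 (by
      convert hw using 1
      funext i
      refine Fin.cases rfl (fun i => ?_) i
      simp [hxs])
    rw [DeltaZero.realize_toFirstOrder hinj hπ] at h₁
    convert h₁ using 1
    funext i
    refine Fin.cases rfl (fun i => ?_) i
    simp [π, hxs, hfix _ (hx i)]

/-! ### Sets of hereditarily bounded cardinality -/

theorem trcl_subset_of_mem {x y : ZFSet.{u}} (h : x ∈ y) : trcl x ⊆ trcl y :=
  trcl_subset (isTransitive_trcl y) ((isTransitive_trcl y).subset_of_mem (subset_trcl y h))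

theorem trcl_subset_self {x : ZFSet.{u}} (h : x.IsTransitive) : trcl x ⊆ x :=
  trcl_subset h fun _ hz => hz

theorem ZFSet.card_le_of_injOn {x y : ZFSet.{u}} (f : ZFSet.{u} → ZFSet.{u})
    (hf : ∀ a ∈ x, f a ∈ y) (hinj : ∀ a ∈ x, ∀ b ∈ x, f a = f b → a = b) : x.card ≤ y.card := by
  rw [← lift_le.{u + 1}, ← ZFSet.cardinalMk_coe_sort, ← ZFSet.cardinalMk_coe_sort]
  exact mk_le_of_injective (f := fun a : x => (⟨f a.1, hf a.1 a.2⟩ : y)) fun a b h =>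
    Subtype.ext (hinj a.1 a.2 b.1 b.2 (congrArg (fun c : y => c.1) h))

theorem ZFSet.exists_injOn_of_card_le {x y : ZFSet.{u}} (h : x.card ≤ y.card) :
    ∃ f : ZFSet.{u} → ZFSet.{u}, (∀ a ∈ x, f a ∈ y) ∧ ∀ a ∈ x, ∀ b ∈ x, f a = f b → a = b := by
  classical
  rw [← lift_le.{u + 1}, ← ZFSet.cardinalMk_coe_sort, ← ZFSet.cardinalMk_coe_sort] at h
  obtain ⟨g⟩ := h
  refine ⟨fun a => if ha : a ∈ x then (g ⟨a, ha⟩).1 else ∅, fun a ha => ?_, fun a ha b hb h => ?_⟩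
  · simp only [dif_pos ha]
    exact (g ⟨a, ha⟩).2
  · simp only [dif_pos ha, dif_pos hb] at h
    exact congrArg (fun c : x => c.1) (g.injective (Subtype.ext h))

theorem ZFSet.exists_range_eq {α : Type u} {x : ZFSet.{u}} (hne : x.Nonempty)
    (h : x.card ≤ #α) : ∃ g : α → ZFSet.{u}, ∀ z, z ∈ x ↔ ∃ i, g i = z := by
  obtain ⟨a, ha⟩ := hne
  have : Nonempty x := ⟨⟨a, ha⟩⟩
  rw [← lift_le.{u + 1}, ← ZFSet.cardinalMk_coe_sort] at h
  rw [← lift_id'.{u, u + 1} #x, lift_mk_le'] at h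
  obtain ⟨g⟩ := h
  refine ⟨fun i => (Function.invFun g i).1, fun z => ⟨fun hz => ?_, ?_⟩⟩
  · obtain ⟨i, hi⟩ := Function.invFun_surjective g.injective ⟨z, hz⟩
    exact ⟨i, congrArg (fun c : x => c.1) hi⟩
  · rintro ⟨i, rfl⟩
    exact (Function.invFun g i).2

/-- The transitive closure of `z` is covered by at most `κ` sets `{b} ∪ trcl b`, each of size at
most `κ`. -/
theorem card_trcl_le_of_forall_mem {κ : Cardinal.{u}} (hκ : ℵ₀ ≤ κ) {z : ZFSet.{u}}
    (hz : z.card ≤ κ) (h : ∀ b ∈ z, (trcl b).card ≤ κ) : (trcl z).card ≤ κ := by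
  let e := equivShrink z
  let t : ZFSet.{u} := ZFSet.iUnion fun i : Shrink.{u} z =>
    insert (e.symm i).1 (trcl (e.symm i).1)
  have hmem : ∀ {c}, c ∈ t ↔ ∃ b ∈ z, c = b ∨ c ∈ trcl b := by
    intro c
    simp only [t, ZFSet.mem_iUnion, ZFSet.mem_insert_iff]
    exact ⟨fun ⟨i, hi⟩ => ⟨_, (e.symm i).2, hi⟩,
      fun ⟨b, hb, h⟩ => ⟨e ⟨b, hb⟩, by rwa [e.symm_apply_apply]⟩⟩
  have ht : t.IsTransitive := by
    intro c hc d hd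
    obtain ⟨b, hb, rfl | hcb⟩ := hmem.1 hc
    · exact hmem.2 ⟨c, hb, .inr (subset_trcl c hd)⟩
    · exact hmem.2 ⟨b, hb, .inr ((isTransitive_trcl b).subset_of_mem hcb hd)⟩
  refine (ZFSet.card_mono (trcl_subset ht fun b hb => hmem.2 ⟨b, hb, .inl rfl⟩)).trans ?_
  have hle : ∀ i : Shrink.{u} z, (insert (e.symm i).1 (trcl (e.symm i).1)).card ≤ κ := fun i =>
    ZFSet.card_insert_le.trans (add_le_of_le hκ (h _ (e.symm i).2) (one_le_aleph0.trans hκ))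
  have h₁ := ZFSet.lift_card_iUnion_le_sum_card
    (f := fun i : Shrink.{u} z => insert (e.symm i).1 (trcl (e.symm i).1))
  rw [lift_id] at h₁
  refine (h₁.trans (sum_le_sum _ _ hle)).trans ?_
  rw [sum_const', ← mul_eq_self hκ]
  exact mul_le_mul' ((mul_eq_self hκ).symm ▸ hz) ((mul_eq_self hκ).symm ▸ le_rfl)

theorem card_trcl_insert_le {κ : Cardinal.{u}} (hκ : ℵ₀ ≤ κ) {x y : ZFSet.{u}}
    (hx : (trcl x).card ≤ κ) (hy : (trcl y).card ≤ κ) : (trcl (insert x y)).card ≤ κ := by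
  refine card_trcl_le_of_forall_mem hκ (ZFSet.card_insert_le.trans (add_le_of_le hκ
    ((ZFSet.card_mono (subset_trcl y)).trans hy) (one_le_aleph0.trans hκ))) fun b hb => ?_
  rcases ZFSet.mem_insert_iff.1 hb with rfl | hb
  · exact hx
  · exact (ZFSet.card_mono (trcl_subset_of_mem hb)).trans hy

theorem card_trcl_empty_le {κ : Cardinal.{u}} : (trcl (∅ : ZFSet.{u})).card ≤ κ :=
  (ZFSet.card_mono (trcl_subset_self ZFSet.isTransitive_empty)).trans (by simp)

theorem card_trcl_singleton_le {κ : Cardinal.{u}} (hκ : ℵ₀ ≤ κ) {x : ZFSet.{u}}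
    (hx : (trcl x).card ≤ κ) : (trcl {x}).card ≤ κ := by
  rw [← LawfulSingleton.insert_empty_eq]
  exact card_trcl_insert_le hκ hx card_trcl_empty_le

/-- Both ranges are transitive, so each value is determined by the earlier ones through the
membership pattern; this is uniqueness of the Mostowski collapse, by induction on `∈`. The
enumerations may repeat values. -/
theorem eq_of_transitive_enumerations {α : Type u} {g g' : α → ZFSet.{u}}
    (hg : ∀ i, ∀ z ∈ g i, ∃ j, g j = z) (hg' : ∀ i, ∀ z ∈ g' i, ∃ j, g' j = z)
    (h : ∀ i j, g i ∈ g j ↔ g' i ∈ g' j) : g = g' := by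
  have key : ∀ y i, g i = y → g' i = y := by
    intro y
    induction y using ZFSet.inductionOn with
    | h y ih =>
      rintro i rfl
      ext z
      constructor
      · intro hz
        obtain ⟨j, rfl⟩ := hg' i z hz
        have hj := (h j i).2 hz
        rwa [ih _ hj j rfl]
      · intro hz
        obtain ⟨j, rfl⟩ := hg i z hz
        have hj := (h j i).1 hz
        rwa [ih _ hz j rfl] at hj
  exact funext fun i => (key _ i rfl).symm

/-- A code in `℘(α × α) × α` for every set of hereditary cardinality at most `#α`. -/
theorem exists_injective_code {α : Type u} (hα : ℵ₀ ≤ #α) :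
    ∃ c : {x : ZFSet.{u} // (trcl x).card ≤ #α} → Set (α × α) × α, Function.Injective c := by
  have hex : ∀ x : {x : ZFSet.{u} // (trcl x).card ≤ #α}, ∃ g : α → ZFSet.{u},
      ∀ z, z ∈ insert x.1 (trcl x.1) ↔ ∃ i, g i = z := fun x =>
    ZFSet.exists_range_eq ⟨x.1, ZFSet.mem_insert _ _⟩
      (ZFSet.card_insert_le.trans (add_le_of_le hα x.2 (one_le_aleph0.trans hα)))
  choose g hg using hex
  have htrans : ∀ x i, ∀ z ∈ g x i, ∃ j, g x j = z := by
    intro x i z hz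
    refine (hg x z).1 (ZFSet.mem_insert_iff.2 (.inr ?_))
    rcases ZFSet.mem_insert_iff.1 ((hg x _).2 ⟨i, rfl⟩) with h | h
    · exact subset_trcl _ (h ▸ hz)
    · exact (isTransitive_trcl _).subset_of_mem h hz
  choose i₀ hi₀ using fun x => (hg x x.1).1 (ZFSet.mem_insert _ _)
  -- The code is the membership pattern of an enumeration of `{x} ∪ trcl x`, with an index at which
  -- `x` itself appears.
  refine ⟨fun x => ({p | g x p.1 ∈ g x p.2}, i₀ x), fun x y h => Subtype.ext ?_⟩
  have h₁ : {p : α × α | g x p.1 ∈ g x p.2} = {p | g y p.1 ∈ g y p.2} := congrArg Prod.fst h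
  have h₂ : i₀ x = i₀ y := congrArg Prod.snd h
  rw [← hi₀, ← hi₀, ← h₂, eq_of_transitive_enumerations (htrans x) (htrans y)
    fun i j => Set.ext_iff.1 h₁ (i, j)]

/-- The sets of hereditary cardinality at most `κ` are the elements of a set of cardinality at most
`2 ^ κ`. -/
theorem exists_hereditary_set {κ : Cardinal.{u}} (hκ : ℵ₀ ≤ κ) :
    ∃ H : ZFSet.{u}, (∀ x, x ∈ H ↔ (trcl x).card ≤ κ) ∧ H.card ≤ 2 ^ κ := by
  obtain ⟨α, rfl⟩ := (⟨κ.out, mk_out κ⟩ : ∃ α : Type u, #α = κ)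
  obtain ⟨c, hc⟩ := exists_injective_code hκ
  have : Small.{u} {x : ZFSet.{u} // (trcl x).card ≤ #α} := small_of_injective hc
  refine ⟨ZFSet.range (Subtype.val : {x : ZFSet.{u} // (trcl x).card ≤ #α} → ZFSet.{u}),
    fun x => by simp, ?_⟩
  have h₁ := ZFSet.lift_card_range_le
    (f := (Subtype.val : {x : ZFSet.{u} // (trcl x).card ≤ #α} → ZFSet.{u}))
  have h₂ := mk_le_of_injective (Equiv.ulift.{u + 1}.symm.injective.comp hc)
  rw [mk_uLift] at h₂
  rw [lift_id'.{u, u + 1}] at h₁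
  refine (lift_le.{u + 1}.1 (h₁.trans h₂)).trans ?_
  -- The number of codes is `2 ^ (κ * κ) * κ`, which is at most `2 ^ κ * 2 ^ κ = 2 ^ κ`.
  rw [mk_prod, lift_id, lift_id, mk_set, mk_prod, lift_id, mul_eq_self hκ]
  have h2 := (cantor #α).le
  exact (mul_le_mul' le_rfl h2).trans (mul_eq_self (hκ.trans h2)).le

/-! ### Bounded certificates for containing all sets of bounded hereditary cardinality -/

/-- `f` relates every element of `A` to at most one element of `M`. -/
def FunctionalOn (A M f : ZFSet.{u}) : Prop :=
  ∀ a ∈ A, ∀ b ∈ M, ∀ c ∈ M, ZFSet.pair a b ∈ f → ZFSet.pair a c ∈ f → b = c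

/-- `z` is the image of `A` under the relation `f`. -/
def IsImageIn (A M f z : ZFSet.{u}) : Prop :=
  ∀ b ∈ M, b ∈ z ↔ ∃ a ∈ A, ZFSet.pair a b ∈ f

/-- `A` is an infinite transitive set, `M` a transitive set that contains the image of `A` under
every function from `A` to `M`, and `Q` is the power set of `M`. -/
structure Certifies (A M Q : ZFSet.{u}) : Prop where
  trans_left : ∀ a ∈ A, ∀ b ∈ a, b ∈ A
  limit : ∃ o ∈ A, (∃ a ∈ o, a = a) ∧ ∀ a ∈ o, ∃ b ∈ o, a ∈ b
  subset : ∀ a ∈ A, a ∈ M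
  trans : ∀ a ∈ M, ∀ b ∈ a, b ∈ M
  pair_mem : ∀ a ∈ M, ∀ b ∈ M, ZFSet.pair a b ∈ M
  powerset : Q = M.powerset
  image : ∀ f ∈ Q, FunctionalOn A M f → ∃ z ∈ M, IsImageIn A M f z

/-- A finite nonempty set would have a member of greatest rank, which belongs to no other member. -/
theorem ZFSet.aleph0_le_card_of_limit {o : ZFSet.{u}} (hne : ∃ a ∈ o, a = a)
    (h : ∀ a ∈ o, ∃ b ∈ o, a ∈ b) : ℵ₀ ≤ o.card := by
  by_contra! hlt
  have hfin : (o : Set ZFSet.{u}).Finite := by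
    have := lift_lt.{u, u + 1}.2 hlt
    rwa [← ZFSet.cardinalMk_coe_sort, lift_aleph0, lt_aleph0_iff_finite] at this
  obtain ⟨a, ha, -⟩ := hne
  obtain ⟨b, hb, hmax⟩ := Set.exists_max_image _ ZFSet.rank hfin ⟨a, ha⟩
  obtain ⟨c, hc, hbc⟩ := h b hb
  exact (hmax c hc).not_gt (ZFSet.rank_lt_of_mem hbc)

theorem Certifies.aleph0_le_card {A M Q : ZFSet.{u}} (h : Certifies A M Q) : ℵ₀ ≤ A.card := by
  obtain ⟨o, ho, hne, hlim⟩ := h.limit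
  exact (ZFSet.aleph0_le_card_of_limit hne hlim).trans (ZFSet.card_mono (h.trans_left o ho))

/-- By induction on `∈` the members of `w` are in `M`. An injection of `w` into `A`, read backwards,
is a partial function from `A` to `M` with image `w`; closure of `M` under such images gives `w ∈
M`. -/
theorem Certifies.mem_of_card_trcl_le {A M Q : ZFSet.{u}} (h : Certifies A M Q) {w : ZFSet.{u}}
    (hw : (trcl w).card ≤ A.card) : w ∈ M := by
  induction w using ZFSet.inductionOn with
  | h w ih =>
    have hwM : ∀ b ∈ w, b ∈ M := fun b hb =>
      ih b hb ((ZFSet.card_mono (trcl_subset_of_mem hb)).trans hw)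
    obtain ⟨g, hg, hinj⟩ :=
      ZFSet.exists_injOn_of_card_le ((ZFSet.card_mono (subset_trcl w)).trans hw)
    -- Separating from `M` loses no pair, since `M` is closed under pairing, and it places `f` in
    -- the power set of `M`.
    let f : ZFSet.{u} := M.sep fun p => ∃ b ∈ w, p = ZFSet.pair (g b) b
    have hf : ∀ {a b}, ZFSet.pair a b ∈ f ↔ b ∈ w ∧ a = g b := by
      intro a b
      simp only [f, ZFSet.mem_sep, ZFSet.pair_inj]
      constructor
      · rintro ⟨-, c, hc, rfl, rfl⟩
        exact ⟨hc, rfl⟩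
      · rintro ⟨hb, rfl⟩
        exact ⟨h.pair_mem _ (h.subset _ (hg b hb)) _ (hwM b hb), b, hb, rfl, rfl⟩
    obtain ⟨z, hz, himg⟩ := h.image f (h.powerset ▸ ZFSet.mem_powerset.2 ZFSet.sep_subset) (by
      intro a _ b _ c _ hb hc
      obtain ⟨hbw, rfl⟩ := hf.1 hb
      obtain ⟨hcw, he⟩ := hf.1 hc
      exact hinj b hbw c hcw he)
    -- `IsImageIn` only speaks of elements of `M`, but both `w` and `z` are subsets of `M`, so they
    -- coincide.
    convert hz
    ext b
    constructor
    · exact fun hb => (himg b (hwM b hb)).2 ⟨g b, hg b hb, hf.2 ⟨hb, rfl⟩⟩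
    · intro hb
      obtain ⟨a, -, hab⟩ := (himg b (h.trans z hz b hb)).1 hb
      exact (hf.1 hab).1

/-- Here `M` is `H_{κ⁺}` and `A` is the transitive closure of `{x, y, ω}`, with `ω` present to make
`A` infinite. Images of `A` have at most `κ` elements, hence lie in `M`; the power set of `M`
accounts for the second exponential. -/
theorem exists_certifies {κ : Cardinal.{u}} (hκ : ℵ₀ ≤ κ) {x y : ZFSet.{u}}
    (hx : (trcl x).card ≤ κ) (hy : (trcl y).card ≤ κ) :
    ∃ A M Q : ZFSet.{u}, Certifies A M Q ∧ x ∈ A ∧ y ∈ A ∧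
      (trcl {A, M, Q}).card ≤ 2 ^ (2 ^ κ : Cardinal.{u}) := by
  obtain ⟨M, hM, hcard⟩ := exists_hereditary_set hκ
  let ω : ZFSet.{u} := (Ordinal.omega0.{u}).toZFSet
  have hω : (trcl ω).card ≤ κ := by
    refine (ZFSet.card_mono (trcl_subset_self ?_)).trans ?_
    · exact fun a ha => (ZFSet.isOrdinal_toZFSet _).subset_of_mem ha
    · simpa [ω] using hκ
  let A := trcl {x, y, ω}
  have hA : A.card ≤ κ :=
    card_trcl_insert_le hκ hx (card_trcl_insert_le hκ hy (card_trcl_singleton_le hκ hω))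
  have hAtrans : A.IsTransitive := isTransitive_trcl _
  have hMtrans : M.IsTransitive := fun a ha b hb =>
    (hM b).2 ((ZFSet.card_mono (trcl_subset_of_mem hb)).trans ((hM a).1 ha))
  have hκ₁ := (cantor κ).le
  have hκ₂ := (cantor (2 ^ κ : Cardinal.{u})).le
  have hinf := hκ.trans (hκ₁.trans hκ₂)
  refine ⟨A, M, M.powerset, ⟨fun a ha => hAtrans a ha, ?_, ?_, hMtrans, ?_, rfl, ?_⟩,
    subset_trcl _ (by simp), subset_trcl _ (by simp), ?_⟩
  · refine ⟨ω, subset_trcl _ (by simp),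
      ⟨_, Ordinal.mem_toZFSet_iff.2 ⟨0, Ordinal.omega0_pos, rfl⟩, rfl⟩,
      fun a ha => ?_⟩
    obtain ⟨o, ho, rfl⟩ := Ordinal.mem_toZFSet_iff.1 ha
    exact ⟨_, Ordinal.mem_toZFSet_iff.2 ⟨_, Ordinal.isSuccLimit_omega0.succ_lt ho, rfl⟩, by
      simp⟩
  · intro a ha
    exact (hM a).2 ((ZFSet.card_mono (trcl_subset hAtrans (hAtrans a ha))).trans hA)
  · intro a ha b hb
    rw [hM] at ha hb ⊢
    exact card_trcl_insert_le hκ (card_trcl_singleton_le hκ ha) (card_trcl_singleton_le hκ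
      (card_trcl_insert_le hκ ha (card_trcl_singleton_le hκ hb)))
  · intro f _ hfun
    let z : ZFSet.{u} := M.sep fun b => ∃ a ∈ A, ZFSet.pair a b ∈ f
    refine ⟨z, (hM z).2 (card_trcl_le_of_forall_mem hκ ?_ fun b hb =>
      (hM b).1 (ZFSet.sep_subset hb)), fun b hb => ?_⟩
    · have : ∀ b, ∃ a, b ∈ z → a ∈ A ∧ ZFSet.pair a b ∈ f := by
        intro b
        by_cases hb : b ∈ z
        · obtain ⟨a, ha⟩ := (ZFSet.mem_sep.1 hb).2
          exact ⟨a, fun _ => ha⟩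
        · exact ⟨∅, fun h => absurd h hb⟩
      choose g hg using this
      refine (ZFSet.card_le_of_injOn g (fun b hb => (hg b hb).1) fun b hb c hc h => ?_).trans hA
      exact hfun _ (hg b hb).1 b (ZFSet.sep_subset hb) c (ZFSet.sep_subset hc) (hg b hb).2
        (h ▸ (hg c hc).2)
    · exact ⟨fun h => (ZFSet.mem_sep.1 h).2, fun h => ZFSet.mem_sep.2 ⟨hb, h⟩⟩
  · refine card_trcl_insert_le hinf ?_ (card_trcl_insert_le hinf ?_
      (card_trcl_singleton_le hinf ?_))
    · exact (ZFSet.card_mono (trcl_subset_self hAtrans)).trans (hA.trans (hκ₁.trans hκ₂))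
    · exact (ZFSet.card_mono (trcl_subset_self hMtrans)).trans (hcard.trans hκ₂)
    · refine (ZFSet.card_mono (trcl_subset_self hMtrans.powerset)).trans ?_
      rw [ZFSet.card_powerset]
      exact power_le_power_left two_ne_zero hcard

/-! ### Predicates defined by bounded formulas -/

/-- `S` is defined by a bounded formula, the predicate symbols being interpreted by `I`. -/
def IsDeltaZero {P : Type} {ar : P → ℕ} (I : (p : P) → (Fin (ar p) → ZFSet.{u}) → Prop) {k : ℕ}
    (S : (Fin k → ZFSet.{u}) → Prop) : Prop :=
  ∃ φ : DeltaZero P ar k, ∀ v, φ.Holds I v ↔ S v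

namespace IsDeltaZero

variable {P : Type} {ar : P → ℕ} {I : (p : P) → (Fin (ar p) → ZFSet.{u}) → Prop} {k : ℕ}
  {S S' : (Fin k → ZFSet.{u}) → Prop}

theorem congr (h : IsDeltaZero I S) (hS : ∀ v, S' v ↔ S v) : IsDeltaZero I S' :=
  let ⟨φ, hφ⟩ := h
  ⟨φ, fun v => (hφ v).trans (hS v).symm⟩

theorem mem (i j : Fin k) : IsDeltaZero I fun v => v i ∈ v j :=
  ⟨.mem i j, fun _ => Iff.rfl⟩

theorem eq (i j : Fin k) : IsDeltaZero I fun v => v i = v j :=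
  ⟨.eq i j, fun _ => Iff.rfl⟩

theorem pred (p : P) (t : Fin (ar p) → Fin k) : IsDeltaZero I fun v => I p fun i => v (t i) :=
  ⟨.pred p t, fun _ => Iff.rfl⟩

theorem not (h : IsDeltaZero I S) : IsDeltaZero I fun v => ¬ S v :=
  let ⟨φ, hφ⟩ := h
  ⟨.neg φ, fun v => not_congr (hφ v)⟩

theorem and (h : IsDeltaZero I S) (h' : IsDeltaZero I S') : IsDeltaZero I fun v => S v ∧ S' v :=
  let ⟨φ, hφ⟩ := h
  let ⟨ψ, hψ⟩ := h'
  ⟨.and φ ψ, fun v => and_congr (hφ v) (hψ v)⟩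

theorem imp (h : IsDeltaZero I S) (h' : IsDeltaZero I S') : IsDeltaZero I fun v => S v → S' v :=
  (h.and h'.not).not.congr fun v => by tauto

theorem or (h : IsDeltaZero I S) (h' : IsDeltaZero I S') : IsDeltaZero I fun v => S v ∨ S' v :=
  (h.not.and h'.not).not.congr fun v => by tauto

theorem iff (h : IsDeltaZero I S) (h' : IsDeltaZero I S') : IsDeltaZero I fun v => (S v ↔ S' v) :=
  ((h.imp h').and (h'.imp h)).congr fun v => by tauto

theorem ball (i : Fin k) {S : ZFSet.{u} → (Fin k → ZFSet.{u}) → Prop}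
    (h : IsDeltaZero I fun v : Fin (k + 1) → ZFSet.{u} => S (v 0) (Fin.tail v)) :
    IsDeltaZero I fun v => ∀ z ∈ v i, S z v :=
  let ⟨φ, hφ⟩ := h
  ⟨.ball i φ, fun v => forall₂_congr fun z _ => hφ (Matrix.vecCons z v)⟩

theorem bex (i : Fin k) {S : ZFSet.{u} → (Fin k → ZFSet.{u}) → Prop}
    (h : IsDeltaZero I fun v : Fin (k + 1) → ZFSet.{u} => S (v 0) (Fin.tail v)) :
    IsDeltaZero I fun v => ∃ z ∈ v i, S z v :=
  (ball i (S := fun z v => ¬ S z v) h.not).not.congr fun v => by push Not; rfl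

theorem eq_singleton (c a : Fin k) : IsDeltaZero I fun v => v c = {v a} :=
  ((mem a c).and (ball c (S := fun e v => e = v a) (.eq 0 a.succ))).congr fun v => by
    constructor
    · intro h
      simp [h]
    · rintro ⟨h₁, h₂⟩
      ext z
      rw [ZFSet.mem_singleton]
      exact ⟨h₂ z, fun h => h ▸ h₁⟩

theorem eq_pair_set (c a b : Fin k) : IsDeltaZero I fun v => v c = {v a, v b} :=
  ((mem a c).and ((mem b c).and (ball c (S := fun e v => e = v a ∨ e = v b)
    ((eq 0 a.succ).or (.eq 0 b.succ))))).congr fun v => by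
    constructor
    · intro h
      simp [h]
    · rintro ⟨h₁, h₂, h₃⟩
      ext z
      rw [ZFSet.mem_pair]
      exact ⟨h₃ z, by rintro (rfl | rfl) <;> assumption⟩

theorem eq_pair (p a b : Fin k) : IsDeltaZero I fun v => v p = ZFSet.pair (v a) (v b) :=
  ((bex p (S := fun c v => c = {v a}) (eq_singleton 0 a.succ)).and
    ((bex p (S := fun c v => c = {v a, v b}) (eq_pair_set 0 a.succ b.succ)).and
      (ball p (S := fun c v => c = {v a} ∨ c = {v a, v b})
        ((eq_singleton 0 a.succ).or (eq_pair_set 0 a.succ b.succ))))).congr fun v => by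
    constructor
    · intro h
      simp [h, ZFSet.pair]
    · rintro ⟨⟨_, h₁, rfl⟩, ⟨_, h₂, rfl⟩, h₃⟩
      ext z
      rw [ZFSet.pair, ZFSet.mem_pair]
      exact ⟨h₃ z, by rintro (rfl | rfl) <;> assumption⟩

theorem pair_mem (a b f : Fin k) : IsDeltaZero I fun v => ZFSet.pair (v a) (v b) ∈ v f :=
  (bex f (S := fun p v => p = ZFSet.pair (v a) (v b)) (eq_pair 0 a.succ b.succ)).congr fun v => by
    simp

theorem functionalOn (A M f : Fin k) : IsDeltaZero I fun v => FunctionalOn (v A) (v M) (v f) := by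
  unfold FunctionalOn
  refine ball A (ball M.succ (ball M.succ.succ (imp ?_ (imp ?_ ?_))))
  · exact pair_mem 2 1 f.succ.succ.succ
  · exact pair_mem 2 0 f.succ.succ.succ
  · exact eq 1 0

theorem isImageIn (A M f z : Fin k) :
    IsDeltaZero I fun v => IsImageIn (v A) (v M) (v f) (v z) := by
  unfold IsImageIn
  exact ball M (iff (mem 0 z.succ) (bex A.succ (pair_mem 0 1 f.succ.succ)))

/-- Bounded formulas are closed under renaming of variables and under replacing predicate symbols
by bounded formulas, with one parameter. -/
theorem holds {P' : Type} {ar' : P' → ℕ}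
    {J : ZFSet.{u} → (p : P') → (Fin (ar' p) → ZFSet.{u}) → Prop}
    (hJ : ∀ (p : P') (m : ℕ) (t : Fin (ar' p) → Fin m) (M : Fin m),
      IsDeltaZero I fun v => J (v M) p fun i => v (t i))
    {l : ℕ} (φ : DeltaZero P' ar' l) {k : ℕ} (ρ : Fin l → Fin k) (M : Fin k) :
    IsDeltaZero I fun v => φ.Holds (J (v M)) fun i => v (ρ i) := by
  induction φ generalizing k with
  | mem i j => exact mem (ρ i) (ρ j)
  | eq i j => exact eq (ρ i) (ρ j)
  | pred p t => exact hJ p k (fun i => ρ (t i)) M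
  | neg φ ih => exact (ih ρ M).not
  | and φ ψ ih₁ ih₂ => exact (ih₁ ρ M).and (ih₂ ρ M)
  | ball i φ ih =>
    refine ball (ρ i) (S := fun z v => φ.Holds (J (v M)) (Matrix.vecCons z fun i => v (ρ i)))
      ((ih (Matrix.vecCons 0 (Fin.succ ∘ ρ)) M.succ).congr fun v => ?_)
    have : (fun i => v (Matrix.vecCons 0 (Fin.succ ∘ ρ) i)) =
        Matrix.vecCons (v 0) fun i => Fin.tail v (ρ i) :=
      funext fun i => by refine Fin.cases ?_ (fun i => ?_) i <;> simp [Fin.tail]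
    rw [this]
    rfl

end IsDeltaZero

/-- `PwSt` is used only for the clause `Q = ℘(M)`; once `Q` is a parameter, quantification over
relations inside `M` is bounded. -/
theorem isDeltaZero_certifies {k : ℕ} (A M Q : Fin k) :
    IsDeltaZero (P := Unit) (ar := fun _ => 2) (fun _ => PwSt)
      fun v => Certifies (v A) (v M) (v Q) := by
  open IsDeltaZero in
  have hpow : IsDeltaZero (P := Unit) (ar := fun _ => 2) (fun _ => PwSt)
      fun v => v Q = (v M).powerset :=
    (pred (I := fun _ => PwSt) () ![M, Q]).congr fun v => by simp [PwSt]
  refine IsDeltaZero.congr (S := fun v => (∀ a ∈ v A, ∀ b ∈ a, b ∈ v A) ∧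
      (∃ o ∈ v A, (∃ a ∈ o, a = a) ∧ ∀ a ∈ o, ∃ b ∈ o, a ∈ b) ∧ (∀ a ∈ v A, a ∈ v M) ∧
      (∀ a ∈ v M, ∀ b ∈ a, b ∈ v M) ∧ (∀ a ∈ v M, ∀ b ∈ v M, ZFSet.pair a b ∈ v M) ∧
      v Q = (v M).powerset ∧
      ∀ f ∈ v Q, FunctionalOn (v A) (v M) f → ∃ z ∈ v M, IsImageIn (v A) (v M) f z) ?_ fun v =>
    ⟨fun h => ⟨h.1, h.2, h.3, h.4, h.5, h.6, h.7⟩,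
      fun ⟨h₁, h₂, h₃, h₄, h₅, h₆, h₇⟩ => ⟨h₁, h₂, h₃, h₄, h₅, h₆, h₇⟩⟩
  refine and ?_ (and ?_ (and ?_ (and ?_ (and ?_ (and hpow ?_)))))
  · exact ball A (ball 0 (mem 0 A.succ.succ))
  · exact bex A (and (bex 0 (eq 0 0)) (ball 0 (bex 1 (mem 1 0))))
  · exact ball A (mem 0 M.succ)
  · exact ball M (ball 0 (mem 0 M.succ.succ))
  · exact ball M (ball M.succ (pair_mem 1 0 M.succ.succ))
  · exact ball Q (imp (functionalOn A.succ M.succ 0)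
      (bex M.succ (isImageIn A.succ.succ M.succ.succ 1 0)))

/-! ### Eliminating the `Π₁` predicate, and the main theorem. -/

theorem DeltaZero.holds_congr_of_transitive {P : Type} {ar : P → ℕ}
    {I I' : (p : P) → (Fin (ar p) → ZFSet.{u}) → Prop} {A : ZFSet.{u}}
    (hA : ∀ a ∈ A, ∀ b ∈ a, b ∈ A) (h : ∀ p x, (∀ i, x i ∈ A) → (I p x ↔ I' p x)) {k : ℕ}
    (φ : DeltaZero P ar k) {v : Fin k → ZFSet.{u}} (hv : ∀ i, v i ∈ A) :
    φ.Holds I v ↔ φ.Holds I' v := by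
  induction φ with
  | mem i j => rfl
  | eq i j => rfl
  | pred p t => exact h p _ fun i => hv (t i)
  | neg φ ih => exact not_congr (ih hv)
  | and φ ψ ih₁ ih₂ => exact and_congr (ih₁ hv) (ih₂ hv)
  | ball i φ ih =>
    exact forall₂_congr fun z hz => ih fun j => Fin.cases (hA _ (hv i) z hz) hv j

/-- A counterexample to the unbounded quantifier can be shrunk to hereditary cardinality at most
`|A|`, and all such sets are in `M`. -/
theorem Certifies.forall_mem_iff {A M Q : ZFSet.{u}} (h : Certifies A M Q) {n : ℕ}
    (θ : PureDeltaZero (n + 1)) {x : Fin n → ZFSet.{u}} (hx : ∀ i, x i ∈ A) :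
    (∀ w ∈ M, θ.Holds (Matrix.vecCons w x)) ↔ ∀ w : ZFSet.{u}, θ.Holds (Matrix.vecCons w x) := by
  refine ⟨fun hM w => ?_, fun hw w _ => hw w⟩
  by_contra hw
  obtain ⟨w', hcard, hw'⟩ := exists_witness_card_trcl_le (.neg θ) (fun a ha => h.trans_left a ha)
    h.aleph0_le_card hx (w := w) hw
  exact hw' (hM w' (h.mem_of_card_trcl_le hcard))

/-- The factor `μ` in the exponent matters: `F μ` may be smaller than `μ`, while the certificate
must also accommodate `x`, so the exponent has to dominate `max μ ν`. -/
theorem le_expBound_expBound {F : Cardinal.{u} → Cardinal.{u}} {μ ν : Cardinal.{u}}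
    (hμ : ℵ₀ ≤ μ) (hν : ℵ₀ ≤ ν) (h : ν ≤ F μ) :
    (2 ^ (2 ^ max μ ν : Cardinal.{u}) : Cardinal.{u}) ≤ expBound (expBound F) μ := by
  have hF : ℵ₀ ≤ F μ := hν.trans h
  have hμ0 : μ ≠ 0 := (aleph0_pos.trans_le hμ).ne'
  have hF0 : F μ ≠ 0 := (aleph0_pos.trans_le hF).ne'
  have h₁ : expBound F μ = 2 ^ (μ * F μ) := if_neg hF0
  have h₂ : expBound (expBound F) μ = 2 ^ (μ * 2 ^ (μ * F μ) : Cardinal.{u}) := by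
    rw [expBound, h₁, if_neg (power_ne_zero _ two_ne_zero)]
  rw [h₂]
  refine power_le_power_left two_ne_zero (le_trans (power_le_power_left two_ne_zero ?_)
    (le_mul_of_one_le_left' (one_le_aleph0.trans hμ)))
  rw [mul_eq_max hμ hF]
  exact max_le_max le_rfl h

theorem lemma7p2 (F : Cardinal.{u} → Cardinal.{u}) (hF : IsDefinablyBounding F) :
    ∃ F'' : Cardinal.{u} → Cardinal.{u}, IsDefinablyBounding F'' ∧
      ∀ (n : ℕ) (R : (Fin n → ZFSet.{u}) → Prop), IsPiOne R →
        ∀ φ : ZFSet.{u} → Prop, IsSigmaOneBounded F R φ → IsSigmaOneBounded F'' PwSt φ := by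
  refine ⟨expBound (expBound F), hF.exp.exp, ?_⟩
  rintro n R ⟨θ, hθ⟩ φ ⟨ψ, hψ, hbd⟩
  let R' : ZFSet.{u} → (Fin n → ZFSet.{u}) → Prop := fun M x =>
    ∀ w ∈ M, θ.Holds (Matrix.vecCons w x)
  have hR : ∀ {A M Q x y}, Certifies A M Q → x ∈ A → y ∈ A →
      (ψ.Holds (R' M) ![x, y] ↔ ψ.Holds R ![x, y]) := by
    intro A M Q x y h hx hy
    refine DeltaZero.holds_congr_of_transitive h.trans_left (fun _ z hz => ?_) ψ ?_
    · exact (h.forall_mem_iff θ hz).trans (hθ z).symm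
    · exact fun i => by fin_cases i <;> assumption
  -- The new witness is any set with the three parts of a certificate among its elements; the old
  -- witness `y` is recovered inside `A`.
  have hdef : IsDeltaZero (P := Unit) (ar := fun _ => 2) (k := 2) (fun _ => PwSt) fun v =>
      ∃ A ∈ v 1, ∃ M ∈ v 1, ∃ Q ∈ v 1,
        Certifies A M Q ∧ v 0 ∈ A ∧ ∃ y ∈ A, ψ.Holds (R' M) ![v 0, y] := by
    open IsDeltaZero in
    refine bex 1 (bex 2 (bex 3 (and (isDeltaZero_certifies 2 1 0) (and (mem 3 2) (bex 2 ?_)))))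
    refine (IsDeltaZero.holds (J := fun M _ => R' M) (fun _ m t M => ?_) ψ ![4, 0] 2).congr
      fun v => ?_
    · refine ball M (S := fun w v => θ.Holds (Matrix.vecCons w fun i => v (t i)))
        ((IsDeltaZero.holds (J := fun _ p => p.elim) (fun p => p.elim) θ
          (Matrix.vecCons 0 (Fin.succ ∘ t)) 0).congr fun v => ?_)
      have : (fun i => v (Matrix.vecCons 0 (Fin.succ ∘ t) i)) =
          Matrix.vecCons (v 0) fun i => Fin.tail v (t i) :=
        funext fun i => by refine Fin.cases ?_ (fun i => ?_) i <;> simp [Fin.tail]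
      rw [this]
      rfl
    · have : (fun i => v (![4, 0] i)) = ![v 4, v 0] :=
        funext fun i => by fin_cases i <;> rfl
      rw [this]
      rfl
  obtain ⟨χ, hχ⟩ := hdef
  have hwit : ∀ x, φ x → ∃ Y, hRank Y ≤ expBound (expBound F) (hRank x) ∧
      DeltaZeroIn.Holds PwSt χ ![x, Y] := by
    intro x hx
    obtain ⟨y, hy, hxy⟩ := hbd x hx
    have hinf : ∀ z : ZFSet.{u}, ℵ₀ ≤ hRank z := fun z => hRank_eq z ▸ le_max_left _ _
    have hcard : ∀ z : ZFSet.{u}, (trcl z).card ≤ hRank z := fun z => hRank_eq z ▸ le_max_right _ _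
    have hmax : ℵ₀ ≤ max (hRank x) (hRank y) := (hinf x).trans (le_max_left _ _)
    obtain ⟨A, M, Q, h, hxA, hyA, hY⟩ := exists_certifies hmax
      ((hcard x).trans (le_max_left _ _)) ((hcard y).trans (le_max_right _ _))
    refine ⟨{A, M, Q}, ?_, (hχ _).2 ⟨A, by simp, M, by simp, Q, by simp, h, hxA, y, hyA,
      (hR h hxA hyA).2 hxy⟩⟩
    refine le_trans ?_ (le_expBound_expBound (hinf x) (hinf y) hy)
    rw [hRank_eq]
    exact max_le (hmax.trans ((cantor _).le.trans (cantor _).le)) hY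
  refine ⟨χ, fun x => ⟨fun hx => (hwit x hx).imp fun _ h => h.2, ?_⟩, hwit⟩
  -- No bound on `Y` is needed here: every certificate, of whatever size, evaluates `R` correctly on
  -- its `A`.
  rintro ⟨Y, hY⟩
  obtain ⟨A, -, M, -, Q, -, h, hxA, y, hyA, hxy⟩ := (hχ _).1 hY
  exact (hψ x).2 ⟨y, (hR h hxA hyA).1 hxy⟩
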